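/- All graphs are finite. A target graph $H$ has no multiple edges but may have loops. For a simple loopless graph $G$, let $\hom(G,H)$ be the number of maps $f:V(G)\to V(H)$ such that $f(u)\sim_H f(v)$ whenever $u\sim_G v$. Let $P_n$ be the path on $n$ vertices and $\mathcal T_n$ the set of trees on $n$ vertices up to isomorphism. The graph $H$ is \emph{Hoffman-London} if $\hom(P_n,H)=\min_{T\in\mathcal T_n}\hom(T,H)$ for all $n\ge 1$, and \emph{strongly Hoffman-London} if $\hom(P_n,H)<\hom(T,H)$ for all $n\ge 1$ and all $T\in\mathcal T_n\setminus\{P_n\}$. The \emph{loop threshold graphs} form the smallest isomorphism-closed family of graphs that contains the one-vertex graph without a loop and the one-vertex graph with a loop, and is closed under adding a new vertex with no neighbour (and no loop) and under adding a new looped vertex adjacent to every vertex. **Theorem.** Every loop threshold graph $H$ is Hoffman-London. Furthermore, a loop threshold graph $H$ is strongly Hoffman-London if and only if the graph obtained from $H$ by deleting all isolated vertices is neither empty (edgeless, possibly without vertices) nor a fully looped complete graph (one in which any two vertices, distinct or equal, are adjacent). Here a vertex $v$ is isolated if $N(v)\subseteq\{v\}$, where $N(v)$ is the set of neighbours of $v$;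 thus a vertex whose only neighbour is itself counts as isolated. -/

import Mathlib

universe u v

/-- A graph without multiple edges, possibly with loops: a symmetric relation on the vertices.
A loop at `v` is the statement `Adj v v`. -/
structure LoopGraph (V : Type u) where
  /-- Adjacency. -/
  Adj : V → V → Prop
  symm : ∀ {a b : V}, Adj a b → Adj b a

namespace LoopGraph

/-- `K₁`, the graph with one vertex and no edge. -/
def single : LoopGraph PUnit.{u + 1} where
  Adj _ _ := False
  symm h := h

/-- `K₁` with a loop, the graph with one vertex and a loop at it. -/
def singleLoop : LoopGraph PUnit.{u + 1} where
  Adj _ _ := True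
  symm h := h

/-- Add to `H` a new vertex `none` that has no neighbour (and no loop). -/
def addIsolated {V : Type u} (H : LoopGraph V) : LoopGraph (Option V) where
  Adj
    | some a, some b => H.Adj a b
    | _, _ => False
  symm {a b} h := by
    cases a <;> cases b <;> first | exact H.symm h | exact h

/-- Add to `H` a new vertex `none` that is adjacent to every old vertex and to itself. -/
def addLoopedDominating {V : Type u} (H : LoopGraph V) : LoopGraph (Option V) where
  Adj
    | some a, some b => H.Adj a b
    | _, _ => True
  symm {a b} h := by
    cases a <;> cases b <;> first | exact H.symm h | exact h

/-- The loop threshold graphs: the smallest isomorphism-closed family of graphs that contains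
`K₁` and `K₁` with a loop, and is closed under adding (unlooped) isolated vertices and under
adding looped dominating vertices. -/
inductive IsLoopThreshold : {V : Type u} → LoopGraph V → Prop
  | single : IsLoopThreshold single
  | singleLoop : IsLoopThreshold singleLoop
  | addIsolated {V : Type u} (H : LoopGraph V) :
      IsLoopThreshold H → IsLoopThreshold H.addIsolated
  | addLoopedDominating {V : Type u} (H : LoopGraph V) :
      IsLoopThreshold H → IsLoopThreshold H.addLoopedDominating
  | iso {V W : Type u} (H : LoopGraph V) (K : LoopGraph W) (e : H.Adj ≃r K.Adj) :
      IsLoopThreshold H → IsLoopThreshold K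

/-- The subgraph of `H` induced on a set `s` of vertices. -/
def induce {V : Type u} (H : LoopGraph V) (s : Set V) : LoopGraph s where
  Adj a b := H.Adj a b
  symm h := H.symm h

/-- A vertex is isolated if it has no neighbour other than, possibly, itself; in particular a
component that consists of one looped vertex is an isolated vertex. -/
def IsIsolated {V : Type u} (H : LoopGraph V) (a : V) : Prop :=
  ∀ b, H.Adj a b → b = a

/-- The graph obtained from `H` by deleting all isolated vertices. -/
def deleteIsolated {V : Type u} (H : LoopGraph V) : LoopGraph {a : V | ¬ H.IsIsolated a} :=
  H.induce {a : V | ¬ H.IsIsolated a}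

/-- A graph is empty if it has no edges and no loops (it may have no vertices at all). -/
def IsEdgeless {V : Type u} (H : LoopGraph V) : Prop :=
  ∀ a b, ¬ H.Adj a b

/-- A graph is a fully looped complete graph if any two vertices, distinct or not, are
adjacent. -/
def IsFullyLoopedComplete {V : Type u} (H : LoopGraph V) : Prop :=
  ∀ a b, H.Adj a b

/-- `hom(G, H)`, the number of `H`-colorings of `G`, that is, of the adjacency-preserving maps
from the vertices of the simple graph `G` to the vertices of `H` (both graphs finite). -/
noncomputable def hom {W : Type v} {V : Type u} (G : SimpleGraph W) (H : LoopGraph V) : ℕ :=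
  Nat.card (G.Adj →r H.Adj)

/-- `H` is Hoffman-London if for each `n ≥ 1` the path on `n` vertices attains the minimum of
`hom(T, H)` over all trees `T` on `n` vertices. -/
def IsHoffmanLondon {V : Type u} (H : LoopGraph V) : Prop :=
  ∀ n : ℕ, 1 ≤ n →
    IsLeast {m : ℕ | ∃ T : SimpleGraph (Fin n), T.IsTree ∧ hom T H = m}
      (hom (SimpleGraph.pathGraph n) H)

/-- `H` is strongly Hoffman-London if for each `n ≥ 1` every tree on `n` vertices that is not
a path admits strictly more `H`-colorings than the path on `n` vertices. -/
def IsStronglyHoffmanLondon {V : Type u} (H : LoopGraph V) : Prop :=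
  ∀ n : ℕ, 1 ≤ n → ∀ T : SimpleGraph (Fin n), T.IsTree →
    ¬ Nonempty (T ≃g SimpleGraph.pathGraph n) →
      hom (SimpleGraph.pathGraph n) H < hom T H

end LoopGraph

/-!
The neighbourhoods of a loop threshold graph `H` are linearly ordered by inclusion
(`IsLoopThreshold.isNested`). Hence for a rooted graph the number of colorings, as a function of the
color of the root, is monotone in that order: the root may be recolored by any vertex with a larger
neighbourhood.

Let `W` be a symmetric matrix, such as a power of the adjacency matrix `A`, and let `c`, `d` be
monotone. Then `⟨c * d, W 1⟩ - ⟨c, W d⟩` is half of the sum of `W a b * (c a - c b) * (d a - d b)`,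
whose terms are nonnegative (`IsNested.dotProduct_mulVec_le`). So if two paths hang at a common
vertex, replacing them by one path of their total length does not increase the number of colorings.
This comparison is kept in the form `Dominates`: `f` dominates `g` if `⟨c, g⟩ ≤ ⟨c, f⟩` for every
monotone `c`, a relation preserved by `A` and by products of monotone functions.

Given a tree and a vertex `x`, deleting leaves other than `x` one at a time and straightening the
branches on the way bounds the number of colorings from below by that of a spider of the same size,
centred at `x`, with one leg for each neighbour of `x` (`exists_weightedHom_ge`). Straightening the
spider as well gives the path, whose colorings are counted by `⟨1, A ^ (n - 1) 1⟩`
(`hom_pathGraph`); so `H` is Hoffman-London.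

A tree that is not a path has a vertex `x` of degree at least three, and then the last step is
strict if `H` has a vertex `d` adjacent to every non-isolated vertex and a non-isolated vertex `a`
that is not adjacent to every non-isolated vertex (`IsSeparated.walkCount_lt_walkProd`). Such `d`
and `a` exist unless `H` without its isolated vertices is fully looped complete, possibly without
vertices. In these exceptional cases adjacency is transitive, so all trees on four vertices have the
same number of colorings, and `H` is not strongly Hoffman-London.
-/

/-! ### Nested neighbourhoods -/

namespace LoopGraph

open Matrix Finset

variable {V : Type u} {H : LoopGraph V}

/-- The neighbourhoods of any two vertices are comparable under inclusion. This is the only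
property of loop threshold graphs that the argument uses. -/
def IsNested (H : LoopGraph V) : Prop :=
  ∀ a b, (∀ x, H.Adj a x → H.Adj b x) ∨ (∀ x, H.Adj b x → H.Adj a x)

theorem IsLoopThreshold.isNested {V : Type u} {H : LoopGraph V} (hH : H.IsLoopThreshold) :
    H.IsNested := by
  induction hH with
  | single => exact fun _ _ => Or.inl fun _ h => h
  | singleLoop => exact fun _ _ => Or.inl fun _ h => h
  | addIsolated H _ ih =>
    rintro (_ | a) (_ | b)
    · exact Or.inl fun _ h => h
    · exact Or.inl fun _ h => h.elim
    · exact Or.inr fun _ h => h.elim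
    · refine (ih a b).imp (fun h => ?_) fun h => ?_ <;>
      · rintro (_ | x) hx
        · exact hx
        · exact h x hx
  | addLoopedDominating H _ ih =>
    rintro (_ | a) (_ | b)
    · exact Or.inl fun _ h => h
    · exact Or.inr fun _ _ => trivial
    · exact Or.inl fun _ _ => trivial
    · refine (ih a b).imp (fun h => ?_) fun h => ?_ <;>
      · rintro (_ | x) hx
        · exact hx
        · exact h x hx
  | iso H K e _ ih =>
    intro a b
    have key : ∀ a b, (∀ x, H.Adj (e.symm a) x → H.Adj (e.symm b) x) →
        ∀ x, K.Adj a x → K.Adj b x := fun a b h x hx =>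
      e.symm.map_rel_iff.1 (h _ (e.symm.map_rel_iff.2 hx))
    exact (ih (e.symm a) (e.symm b)).imp (key a b) (key b a)

/-- A function on the vertices that is monotone in the neighbourhood preorder: it does not decrease
when the neighbourhood grows. Counting the colorings of a rooted graph by the color of the root
gives such functions. -/
def NbhdMono (H : LoopGraph V) (c : V → ℕ) : Prop :=
  ∀ a b, (∀ x, H.Adj a x → H.Adj b x) → c a ≤ c b

theorem nbhdMono_one : H.NbhdMono 1 := fun _ _ _ => le_rfl

theorem NbhdMono.mul {c d : V → ℕ} (hc : H.NbhdMono c) (hd : H.NbhdMono d) :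
    H.NbhdMono (c * d) := fun a b h => Nat.mul_le_mul (hc a b h) (hd a b h)

/-- Two monotone functions are similarly ordered, so the rearrangement inequality holds at any two
vertices. -/
theorem IsNested.mul_add_mul_le (hH : H.IsNested) {c d : V → ℕ} (hc : H.NbhdMono c)
    (hd : H.NbhdMono d) (a b : V) : c a * d b + c b * d a ≤ c a * d a + c b * d b := by
  rcases hH a b with h | h
  · have h₁ := hc a b h
    have h₂ := hd a b h
    nlinarith [Nat.mul_le_mul h₁ h₂, mul_add_mul_le_mul_add_mul h₁ h₂]
  · have h₁ := hc b a h
    have h₂ := hd b a h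
    nlinarith [Nat.mul_le_mul h₁ h₂, mul_add_mul_le_mul_add_mul h₁ h₂]

section Fintype

variable [Fintype V]

open Classical in
/-- The adjacency matrix over `ℕ`; a loop contributes the diagonal entry `1`. -/
noncomputable def adjMatrix (H : LoopGraph V) : Matrix V V ℕ :=
  Matrix.of fun a b => if H.Adj a b then 1 else 0

omit [Fintype V] in
theorem adjMatrix_transpose : H.adjMatrixᵀ = H.adjMatrix := by
  ext a b
  have hab : H.Adj b a ↔ H.Adj a b := ⟨H.symm, H.symm⟩
  by_cases h : H.Adj a b <;> simp [adjMatrix, hab, h]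

open Classical in
theorem adjMatrix_mulVec_apply (c : V → ℕ) (a : V) :
    (H.adjMatrix *ᵥ c) a = ∑ b, if H.Adj a b then c b else 0 := by
  simp [adjMatrix, mulVec, dotProduct]

theorem dotProduct_adjMatrix_mulVec (c d : V → ℕ) :
    c ⬝ᵥ H.adjMatrix *ᵥ d = H.adjMatrix *ᵥ c ⬝ᵥ d := by
  rw [dotProduct_mulVec, ← mulVec_transpose, adjMatrix_transpose]

theorem nbhdMono_adjMatrix_mulVec (c : V → ℕ) : H.NbhdMono (H.adjMatrix *ᵥ c) := by
  classical
  intro a b h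
  simp only [adjMatrix_mulVec_apply]
  refine sum_le_sum fun x _ => ?_
  by_cases hx : H.Adj a x
  · simp [hx, h x hx]
  · simp [hx]

open Classical in
/-- `H.walkCount k a` is the number of walks with `k` edges starting at `a`, i.e. the number of
colorings of a path with `k` edges whose first vertex has color `a`. -/
noncomputable def walkCount (H : LoopGraph V) (k : ℕ) : V → ℕ := H.adjMatrix ^ k *ᵥ 1

@[simp] theorem walkCount_zero : H.walkCount 0 = 1 := by simp [walkCount]

theorem walkCount_succ (k : ℕ) : H.walkCount (k + 1) = H.adjMatrix *ᵥ H.walkCount k := by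
  simp [walkCount, pow_succ']

theorem nbhdMono_walkCount (k : ℕ) : H.NbhdMono (H.walkCount k) := by
  cases k with
  | zero => rw [walkCount_zero]; exact nbhdMono_one
  | succ k => rw [walkCount_succ]; exact nbhdMono_adjMatrix_mulVec _

/-! ### A correlation inequality for nested neighbourhoods -/

section Correlation

variable {W : Matrix V V ℕ} {c d : V → ℕ}

theorem two_mul_mul_dotProduct_mulVec_one (hW : Wᵀ = W) :
    2 * ((c * d) ⬝ᵥ W *ᵥ 1) = ∑ a, ∑ b, W a b * (c a * d a + c b * d b) := by
  have hs : ∀ a b, W b a = W a b := fun a b => congrFun₂ hW a b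
  have h₁ : (c * d) ⬝ᵥ W *ᵥ 1 = ∑ a, ∑ b, W a b * (c a * d a) := by
    simp only [dotProduct, mulVec, mul_sum, Pi.mul_apply, Pi.one_apply, mul_one]
    exact sum_congr rfl fun a _ => sum_congr rfl fun b _ => mul_comm _ _
  have h₂ : (c * d) ⬝ᵥ W *ᵥ 1 = ∑ a, ∑ b, W a b * (c b * d b) := by
    rw [h₁, sum_comm]
    exact sum_congr rfl fun a _ => sum_congr rfl fun b _ => by rw [hs]
  rw [two_mul]
  nth_rewrite 1 [h₁]
  rw [h₂]
  simp only [← sum_add_distrib, mul_add]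

theorem two_mul_dotProduct_mulVec (hW : Wᵀ = W) :
    2 * (c ⬝ᵥ W *ᵥ d) = ∑ a, ∑ b, W a b * (c a * d b + c b * d a) := by
  have hs : ∀ a b, W b a = W a b := fun a b => congrFun₂ hW a b
  have h₁ : c ⬝ᵥ W *ᵥ d = ∑ a, ∑ b, W a b * (c a * d b) := by
    simp only [dotProduct, mulVec, mul_sum]
    exact sum_congr rfl fun a _ => sum_congr rfl fun b _ => by ring
  have h₂ : c ⬝ᵥ W *ᵥ d = ∑ a, ∑ b, W a b * (c b * d a) := by
    rw [h₁, sum_comm]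
    exact sum_congr rfl fun a _ => sum_congr rfl fun b _ => by rw [hs]
  rw [two_mul]
  nth_rewrite 1 [h₁]
  rw [h₂]
  simp only [← sum_add_distrib, mul_add]

/-- The correlation inequality. If `W` counts walks of a given length, the left side counts the
colorings of two rooted graphs joined by a path, and the right side those of the graph in which both
are attached at the same end of the path. Symmetrising in the two ends makes the difference a sum of
`W a b * (c a - c b) * (d a - d b) ≥ 0`. -/
theorem IsNested.dotProduct_mulVec_le (hH : H.IsNested) (hW : Wᵀ = W) (hc : H.NbhdMono c)
    (hd : H.NbhdMono d) : c ⬝ᵥ W *ᵥ d ≤ (c * d) ⬝ᵥ W *ᵥ 1 := by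
  refine Nat.le_of_mul_le_mul_left ?_ two_pos
  rw [two_mul_mul_dotProduct_mulVec_one hW, two_mul_dotProduct_mulVec hW]
  exact sum_le_sum fun a _ => sum_le_sum fun b _ =>
    Nat.mul_le_mul_left _ (hH.mul_add_mul_le hc hd a b)

/-- The correlation inequality is strict as soon as one pair of ends contributes. -/
theorem IsNested.dotProduct_mulVec_lt (hH : H.IsNested) (hW : Wᵀ = W) (hc : H.NbhdMono c)
    (hd : H.NbhdMono d) {a b : V} (hab : 0 < W a b) (hca : c b < c a) (hda : d b < d a) :
    c ⬝ᵥ W *ᵥ d < (c * d) ⬝ᵥ W *ᵥ 1 := by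
  refine Nat.lt_of_mul_lt_mul_left (a := 2) ?_
  rw [two_mul_mul_dotProduct_mulVec_one hW, two_mul_dotProduct_mulVec hW]
  have key : ∀ x y, W x y * (c x * d y + c y * d x) ≤ W x y * (c x * d x + c y * d y) :=
    fun x y => Nat.mul_le_mul_left _ (hH.mul_add_mul_le hc hd x y)
  refine sum_lt_sum (fun x _ => sum_le_sum fun y _ => key x y) ⟨a, mem_univ _, ?_⟩
  refine sum_lt_sum (fun y _ => key a y) ⟨b, mem_univ _, ?_⟩
  refine Nat.mul_lt_mul_of_pos_left ?_ hab
  linarith [mul_add_mul_lt_mul_add_mul hca hda]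

end Correlation

/-! ### The dominance order on root counts -/

theorem transpose_adjMatrix_pow [DecidableEq V] (k : ℕ) :
    (H.adjMatrix ^ k)ᵀ = H.adjMatrix ^ k := by
  rw [transpose_pow, adjMatrix_transpose]

theorem walkCount_add [DecidableEq V] (s t : ℕ) :
    H.walkCount (s + t) = H.adjMatrix ^ t *ᵥ H.walkCount s := by
  have : H.walkCount = fun k => H.adjMatrix ^ k *ᵥ (1 : V → ℕ) := by
    funext k
    unfold walkCount
    congr!
  simp [this, add_comm s t, pow_add]

theorem walkCount_eq [DecidableEq V] (t : ℕ) : H.walkCount t = H.adjMatrix ^ t *ᵥ 1 := by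
  simpa using walkCount_add (H := H) 0 t

/-- `f` dominates `g` if it has the larger inner product with every monotone function: for root
counts `f` and `g` this says that replacing a branch counted by `f` by one counted by `g`, in any
surroundings, does not increase the number of colorings. -/
def Dominates (H : LoopGraph V) (f g : V → ℕ) : Prop :=
  ∀ c, H.NbhdMono c → c ⬝ᵥ g ≤ c ⬝ᵥ f

theorem Dominates.refl (f : V → ℕ) : H.Dominates f f := fun _ _ => le_rfl

theorem Dominates.trans {f g h : V → ℕ} (h₁ : H.Dominates f g) (h₂ : H.Dominates g h) :
    H.Dominates f h := fun c hc => (h₂ c hc).trans (h₁ c hc)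

theorem Dominates.adjMatrix_mulVec {f g : V → ℕ} (h : H.Dominates f g) :
    H.Dominates (H.adjMatrix *ᵥ f) (H.adjMatrix *ᵥ g) := fun c _ => by
  rw [dotProduct_adjMatrix_mulVec, dotProduct_adjMatrix_mulVec]
  exact h _ (nbhdMono_adjMatrix_mulVec c)

theorem dotProduct_mul (c f g : V → ℕ) : c ⬝ᵥ (f * g) = (c * f) ⬝ᵥ g := by
  simp [dotProduct, mul_assoc]

theorem Dominates.mul_left {f g k : V → ℕ} (h : H.Dominates f g) (hk : H.NbhdMono k) :
    H.Dominates (k * f) (k * g) := fun c hc => by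
  rw [dotProduct_mul, dotProduct_mul]
  exact h _ (hc.mul hk)

theorem Dominates.mul {f g f' g' : V → ℕ} (h : H.Dominates f g) (h' : H.Dominates f' g')
    (hf' : H.NbhdMono f') (hg : H.NbhdMono g) : H.Dominates (f * f') (g * g') := by
  have := h.mul_left hf'
  rw [mul_comm f' f, mul_comm f' g] at this
  exact this.trans (h'.mul_left hg)

/-- Two paths attached at a vertex dominate the single path obtained by concatenating them. -/
theorem IsNested.dominates_walkCount_mul (hH : H.IsNested) (s t : ℕ) :
    H.Dominates (H.walkCount s * H.walkCount t) (H.walkCount (s + t)) := fun c hc => by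
  classical
  rw [dotProduct_mul, walkCount_add, walkCount_eq t]
  exact hH.dotProduct_mulVec_le (transpose_adjMatrix_pow t) hc (nbhdMono_walkCount s)

/-- The product of the functions `H.walkCount t` for `t` in `L`: it counts the colorings of a
spider with legs of lengths `t ∈ L` by the color of its centre. -/
noncomputable def walkProd (H : LoopGraph V) (L : Multiset ℕ) : V → ℕ :=
  (L.map H.walkCount).prod

@[simp] theorem walkProd_zero : H.walkProd 0 = 1 := rfl

@[simp] theorem walkProd_cons (t : ℕ) (L : Multiset ℕ) :
    H.walkProd (t ::ₘ L) = H.walkCount t * H.walkProd L := by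
  simp [walkProd]

theorem nbhdMono_walkProd (L : Multiset ℕ) : H.NbhdMono (H.walkProd L) := by
  induction L using Multiset.induction with
  | empty => exact nbhdMono_one
  | cons t L ih => rw [walkProd_cons]; exact (nbhdMono_walkCount t).mul ih

theorem IsNested.dominates_walkProd (hH : H.IsNested) (L : Multiset ℕ) :
    H.Dominates (H.walkProd L) (H.walkCount L.sum) := by
  induction L using Multiset.induction with
  | empty => simpa using Dominates.refl _
  | cons t L ih =>
    rw [walkProd_cons, Multiset.sum_cons]
    exact (ih.mul_left (nbhdMono_walkCount t)).trans (hH.dominates_walkCount_mul _ _)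

/-! ### Strict inequality for spiders with three legs -/

/-- `d` is a looped vertex whose neighbourhood contains that of `a`, and strictly so because of `b`,
with both `a` and `b` adjacent to `d`. Such a triple makes the correlation inequality strict. -/
structure IsSeparated (H : LoopGraph V) (d a b : V) : Prop where
  loop : H.Adj d d
  adj_left : H.Adj d a
  adj_right : H.Adj d b
  not_adj : ¬ H.Adj a b
  le : ∀ x, H.Adj a x → H.Adj d x

namespace IsSeparated

variable {d a b : V}

theorem pos_of_walkCount (h : H.IsSeparated d a b) (k : ℕ) {x : V} (hx : H.Adj x d) :
    0 < H.walkCount k x := by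
  classical
  induction k generalizing x with
  | zero => simp
  | succ k ih =>
    rw [walkCount_succ, adjMatrix_mulVec_apply]
    refine sum_pos' (fun _ _ => Nat.zero_le _) ⟨d, mem_univ _, ?_⟩
    rw [if_pos hx]
    exact ih h.loop

theorem walkCount_lt (h : H.IsSeparated d a b) {t : ℕ} (ht : 0 < t) :
    H.walkCount t a < H.walkCount t d := by
  classical
  obtain ⟨k, rfl⟩ := Nat.exists_eq_succ_of_ne_zero ht.ne'
  rw [Nat.succ_eq_add_one, walkCount_succ, adjMatrix_mulVec_apply, adjMatrix_mulVec_apply]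
  refine sum_lt_sum (fun x _ => ?_) ⟨b, mem_univ _, ?_⟩
  · by_cases hx : H.Adj a x
    · simp [hx, h.le x hx]
    · simp [hx]
  · rw [if_neg h.not_adj, if_pos h.adj_right]
    exact h.pos_of_walkCount k (H.symm h.adj_right)

theorem pos_of_walkProd (h : H.IsSeparated d a b) (L : Multiset ℕ) : 0 < H.walkProd L d := by
  induction L using Multiset.induction with
  | empty => simp
  | cons t L ih =>
    rw [walkProd_cons]
    exact Nat.mul_pos (h.pos_of_walkCount t h.loop) ih

theorem adjMatrix_pow_pos [DecidableEq V] (h : H.IsSeparated d a b) {t : ℕ} (ht : 0 < t) :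
    0 < (H.adjMatrix ^ t) d a := by
  have hA : ∀ {x y}, H.Adj x y → H.adjMatrix x y = 1 := fun {x y} hxy => by
    simp [adjMatrix, hxy]
  have key : ∀ k, 0 < (H.adjMatrix ^ k) d d := by
    intro k
    induction k with
    | zero => simp
    | succ k ih =>
      rw [pow_succ, mul_apply]
      exact sum_pos' (fun _ _ => Nat.zero_le _)
        ⟨d, mem_univ _, by rw [hA h.loop, mul_one]; exact ih⟩
  obtain ⟨k, rfl⟩ := Nat.exists_eq_succ_of_ne_zero ht.ne'
  rw [Nat.succ_eq_add_one, pow_succ, mul_apply]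
  exact sum_pos' (fun _ _ => Nat.zero_le _)
    ⟨d, mem_univ _, by rw [hA h.adj_left, mul_one]; exact key k⟩

/-- A spider with at least three legs has strictly more colorings than the path of the same size:
concatenating two legs already loses, because the count `c` for the remaining ones separates `a`
from `d`. -/
theorem walkCount_lt_walkProd (h : H.IsSeparated d a b) (hH : H.IsNested) {L : Multiset ℕ}
    (hL : 3 ≤ L.card) (hpos : ∀ t ∈ L, 0 < t) :
    1 ⬝ᵥ H.walkCount L.sum < 1 ⬝ᵥ H.walkProd L := by
  classical
  obtain ⟨r, L, rfl⟩ := Multiset.card_pos_iff_exists_mem.1 (by omega : 0 < L.card) |>.imp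
    fun r hr => Multiset.exists_cons_of_mem hr
  obtain ⟨s, L, rfl⟩ := Multiset.card_pos_iff_exists_mem.1
    (by simp at hL; omega : 0 < L.card) |>.imp fun r hr => Multiset.exists_cons_of_mem hr
  obtain ⟨t, L, rfl⟩ := Multiset.card_pos_iff_exists_mem.1
    (by simp at hL; omega : 0 < L.card) |>.imp fun r hr => Multiset.exists_cons_of_mem hr
  have hr : 0 < r := hpos r (by simp)
  have hs : 0 < s := hpos s (by simp)
  have ht : 0 < t := hpos t (by simp)
  set c : V → ℕ := H.walkProd (r ::ₘ L) with hc
  have hca : c a < c d := by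
    rw [hc, walkProd_cons]
    exact Nat.mul_lt_mul_of_lt_of_le (h.walkCount_lt hr) (nbhdMono_walkProd L a d h.le)
      (h.pos_of_walkProd L)
  have h₁ : c ⬝ᵥ H.walkCount (s + t) < (c * H.walkCount s) ⬝ᵥ H.walkCount t := by
    rw [walkCount_add, walkCount_eq t]
    exact hH.dotProduct_mulVec_lt (transpose_adjMatrix_pow t) (nbhdMono_walkProd _)
      (nbhdMono_walkCount s) (h.adjMatrix_pow_pos ht) hca (h.walkCount_lt hs)
  have h₂ := hH.dominates_walkProd ((s + t) ::ₘ r ::ₘ L) 1 nbhdMono_one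
  calc _ = 1 ⬝ᵥ H.walkCount ((s + t) ::ₘ r ::ₘ L).sum := by
        congr 2; simp only [Multiset.sum_cons]; ring
    _ ≤ 1 ⬝ᵥ H.walkProd ((s + t) ::ₘ r ::ₘ L) := h₂
    _ = c ⬝ᵥ H.walkCount (s + t) := by
        rw [walkProd_cons, mul_comm, dotProduct_mul, one_mul]
    _ < _ := h₁
    _ = _ := by
        rw [← dotProduct_mul, ← one_mul c, ← dotProduct_mul]
        congr 1
        simp only [hc, walkProd_cons]
        ring

end IsSeparated

end Fintype

end LoopGraph

/-! ### Counting colorings of trees by deleting leaves -/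

namespace LoopGraph

open Matrix Finset

variable {V : Type u} [Fintype V] {H : LoopGraph V}

/-- The map `f` is an `H`-coloring of `T`, the unbundled form of `T.Adj →r H.Adj`. -/
def IsColoring {W : Type v} (T : SimpleGraph W) (H : LoopGraph V) (f : W → V) : Prop :=
  ∀ i j, T.Adj i j → H.Adj (f i) (f j)

omit [Fintype V] in
theorem hom_eq_card {W : Type v} (T : SimpleGraph W) :
    hom T H = Nat.card {f : W → V // IsColoring T H f} :=
  Nat.card_congr
    { toFun := fun f => ⟨f, fun _ _ h => f.map_rel h⟩
      invFun := fun f => ⟨f.1, fun h => f.2 _ _ h⟩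
      left_inv := fun _ => rfl
      right_inv := fun _ => rfl }

section Weighted

variable {W : Type v} [Fintype W] [DecidableEq W]

open Classical in
/-- The number of `H`-colorings of `T`, where the coloring `f` counts with weight
`∏ i, w i (f i)`. -/
noncomputable def weightedHom (T : SimpleGraph W) (H : LoopGraph V) (w : W → V → ℕ) : ℕ :=
  ∑ f : W → V, if IsColoring T H f then ∏ i, w i (f i) else 0

theorem hom_eq_weightedHom (T : SimpleGraph W) : hom T H = weightedHom T H 1 := by
  classical
  rw [hom_eq_card, Nat.card_eq_fintype_card, Fintype.card_subtype]
  simp [weightedHom]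

theorem weightedHom_of_unique [Unique W] (T : SimpleGraph W) (w : W → V → ℕ) :
    weightedHom T H w = 1 ⬝ᵥ w default := by
  classical
  have h : ∀ f : W → V, IsColoring T H f := fun f i j hij =>
    (T.ne_of_adj hij (Subsingleton.elim i j)).elim
  simp only [weightedHom, h, if_true, Fintype.prod_unique, one_dotProduct]
  exact Fintype.sum_equiv (M := ℕ) (Equiv.funUnique W V) _ _ fun f => rfl

/-- Summing over the color of a leaf `l` moves its weight, transported by the adjacency matrix, to
its neighbour `p`. -/
theorem weightedHom_eq_of_leaf {T : SimpleGraph W} {l p : W} (hlp : T.Adj l p)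
    (hl : ∀ x, T.Adj l x → x = p) (w : W → V → ℕ) :
    weightedHom T H w = weightedHom (T.comap ((↑) : {j // j ≠ l} → W)) H
      fun i => if (i : W) = p then w p * H.adjMatrix *ᵥ w l else w i := by
  classical
  have hpl : p ≠ l := (T.ne_of_adj hlp).symm
  let p' : {j // j ≠ l} := ⟨p, hpl⟩
  have hcol : ∀ f : W → V, IsColoring T H f ↔
      H.Adj (f p) (f l) ∧ IsColoring (T.comap ((↑) : {j // j ≠ l} → W)) H fun i => f i := by
    refine fun f => ⟨fun hf => ⟨hf _ _ hlp.symm, fun i j hij => hf _ _ hij⟩, ?_⟩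
    rintro ⟨h₁, h₂⟩ i j hij
    by_cases hi : i = l
    · subst hi
      rw [hl j hij]
      exact H.symm h₁
    by_cases hj : j = l
    · subst hj
      rw [hl i hij.symm]
      exact h₁
    exact h₂ ⟨i, hi⟩ ⟨j, hj⟩ hij
  have hprod : ∀ g : W → ℕ, ∏ i, g i = g l * ∏ i : {j // j ≠ l}, g i := fun g =>
    Fintype.prod_eq_mul_prod_subtype_ne g l
  have hlhs : weightedHom T H w = ∑ x : V × ({j // j ≠ l} → V),
      if H.Adj (x.2 p') x.1 ∧ IsColoring (T.comap ((↑) : {j // j ≠ l} → W)) H x.2 then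
        w l x.1 * ∏ i : {j // j ≠ l}, w i (x.2 i) else 0 := by
    refine Fintype.sum_equiv (M := ℕ) (Equiv.funSplitAt l V) _ _ fun f => ?_
    rw [hprod]
    exact if_congr (hcol f) rfl rfl
  rw [hlhs, Fintype.sum_prod_type_right]
  refine sum_congr rfl fun g _ => ?_
  by_cases hg : IsColoring (T.comap ((↑) : {j // j ≠ l} → W)) H g
  · have hrhs : (∏ i : {j // j ≠ l},
        (if (i : W) = p then w p * H.adjMatrix *ᵥ w l else w i) (g i)) =
        (H.adjMatrix *ᵥ w l) (g p') * ∏ i : {j // j ≠ l}, w i (g i) := by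
      have : ∀ i : {j // j ≠ l}, (if (i : W) = p then w p * H.adjMatrix *ᵥ w l else w i) (g i) =
          (if i = p' then (H.adjMatrix *ᵥ w l) (g p') else 1) * w i (g i) := by
        intro i
        by_cases hi : i = p'
        · subst hi
          simp [p', mul_comm]
        · have : (i : W) ≠ p := fun h => hi (Subtype.ext h)
          simp [hi, this]
      simp only [this, prod_mul_distrib, prod_ite_eq', mem_univ, if_true]
    rw [if_pos hg, hrhs, adjMatrix_mulVec_apply, sum_mul]
    refine sum_congr rfl fun a _ => ?_
    simp [hg]
  · simp [hg]

end Weighted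

/-! ### Colorings of paths -/

open Classical in
theorem sum_chain_eq (n : ℕ) (c : V → ℕ) :
    (∑ f : Fin (n + 1) → V,
      if ∀ i : Fin n, H.Adj (f i.castSucc) (f i.succ) then c (f 0) else 0) =
      c ⬝ᵥ H.walkCount n := by
  induction n generalizing c with
  | zero =>
    simp only [IsEmpty.forall_iff, if_true, walkCount_zero, dotProduct_one]
    exact Fintype.sum_equiv (M := ℕ) (Equiv.funUnique (Fin 1) V) _ _ fun f => rfl
  | succ n ih =>
    rw [walkCount_succ, dotProduct_adjMatrix_mulVec, ← ih]
    rw [← (Fin.consEquiv fun _ => V).sum_comp, Fintype.sum_prod_type_right]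
    refine sum_congr rfl fun g _ => ?_
    have h : ∀ a, (∀ i : Fin (n + 1), H.Adj ((Fin.cons a g : Fin (n + 2) → V) i.castSucc)
        ((Fin.cons a g : Fin (n + 2) → V) i.succ)) ↔
        H.Adj a (g 0) ∧ ∀ i : Fin n, H.Adj (g i.castSucc) (g i.succ) := by
      intro a
      rw [Fin.forall_fin_succ]
      refine and_congr (by simp) (forall_congr' fun i => ?_)
      rw [Fin.castSucc_succ, Fin.cons_succ, Fin.cons_succ]
    simp only [Fin.consEquiv_apply, h, Fin.cons_zero]
    by_cases hg : ∀ i : Fin n, H.Adj (g i.castSucc) (g i.succ)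
    · have hs : ∀ a, H.Adj a (g 0) ↔ H.Adj (g 0) a := fun a => ⟨H.symm, H.symm⟩
      simp [hg, adjMatrix_mulVec_apply, hs]
    · simp [hg]

theorem hom_pathGraph (n : ℕ) :
    hom (SimpleGraph.pathGraph (n + 1)) H = 1 ⬝ᵥ H.walkCount n := by
  classical
  rw [← sum_chain_eq, hom_eq_weightedHom, weightedHom]
  refine sum_congr rfl fun f _ => if_congr ?_ (by simp) rfl
  refine ⟨fun hf i => hf _ _ (by simp [SimpleGraph.pathGraph_adj]), fun hf i j hij => ?_⟩
  have key : ∀ i j : Fin (n + 1), i.val + 1 = j.val → H.Adj (f i) (f j) := by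
    intro i j h
    have := hf ⟨i, by omega⟩
    rwa [show (⟨i, by omega⟩ : Fin n).succ = j from Fin.ext h] at this
  rw [SimpleGraph.pathGraph_adj] at hij
  exact hij.elim (key i j) fun h => H.symm (key j i h)

/-! ### Reducing a tree to a spider -/

/-- Reduction of a tree to a spider centred at `x`. The weight at each vertex `i` dominates a spider
with legs `L i`; deleting a leaf `l ≠ x` straightens its spider to a path, which becomes, one edge
longer, a new leg at the neighbour of `l`. The centre `x` thus gains one leg for each of its
neighbours. -/
theorem exists_weightedHom_ge (n : ℕ) {W : Type v} [Fintype W] [DecidableEq W]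
    (T : SimpleGraph W) (hT : T.IsTree) (hn : Fintype.card W = n + 1) (x : W) (w : W → V → ℕ)
    (hw : ∀ i, H.NbhdMono (w i)) (L : W → Multiset ℕ)
    (hL : ∀ i, H.Dominates (w i) (H.walkProd (L i))) (hpos : ∀ i, ∀ t ∈ L i, 0 < t)
    (hH : H.IsNested) :
    ∃ M : Multiset ℕ, M.card = (T.neighborSet x).ncard + (L x).card ∧
      M.sum = ∑ i, (L i).sum + n ∧ (∀ t ∈ M, 0 < t) ∧
      1 ⬝ᵥ H.walkProd M ≤ weightedHom T H w := by
  classical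
  induction n generalizing W with
  | zero =>
    have : Unique W := Fintype.card_eq_one_iff_nonempty_unique.1 hn |>.some
    refine ⟨L x, by simp, ?_, hpos x, ?_⟩
    · rw [Fintype.sum_unique, Subsingleton.elim x default, add_zero]
    · rw [weightedHom_of_unique, Subsingleton.elim x default]
      exact hL _ 1 nbhdMono_one
  | succ n ih =>
    have : Nontrivial W := Fintype.one_lt_card_iff_nontrivial.1 (by omega)
    obtain ⟨l, hlx, hdeg⟩ : ∃ l, l ≠ x ∧ T.degree l = 1 := by
      obtain ⟨u, v, huv, hu, hv⟩ := hT.exists_ne_and_degree_eq_one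
      by_cases hux : u = x
      · exact ⟨v, fun h => huv (hux.trans h.symm), hv⟩
      · exact ⟨u, hux, hu⟩
    obtain ⟨p, hlp, hl⟩ := SimpleGraph.degree_eq_one_iff_existsUnique_adj.1 hdeg
    have hpl : p ≠ l := (T.ne_of_adj hlp).symm
    have hT' : (T.comap ((↑) : {j // j ≠ l} → W)).IsTree :=
      ⟨hT.connected.induce_compl_singleton_of_degree_eq_one hdeg, hT.isAcyclic.induce _⟩
    let x' : {j // j ≠ l} := ⟨x, hlx.symm⟩
    let L' : {j // j ≠ l} → Multiset ℕ := fun i =>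
      if (i : W) = p then ((L l).sum + 1) ::ₘ L p else L i
    obtain ⟨M, hcard, hsum, hMpos, hM⟩ := ih (T.comap ((↑) : {j // j ≠ l} → W)) hT'
      (by simp [Fintype.card_subtype_compl, hn]) x'
      (fun i => if (i : W) = p then w p * H.adjMatrix *ᵥ w l else w i)
      (fun i => by
        split_ifs
        · exact (hw p).mul (nbhdMono_adjMatrix_mulVec _)
        · exact hw i)
      L'
      (fun i => by
        simp only [L']
        split_ifs
        · rw [walkProd_cons, walkCount_succ, mul_comm (H.adjMatrix *ᵥ _)]
          exact (hL p).mul ((hL l).trans (hH.dominates_walkProd _)).adjMatrix_mulVec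
            (nbhdMono_adjMatrix_mulVec _) (nbhdMono_walkProd _)
        · exact hL i)
      (fun i => by
        simp only [L']
        split_ifs
        · intro t ht
          rcases Multiset.mem_cons.1 ht with rfl | ht
          · omega
          · exact hpos p t ht
        · exact hpos i)
    refine ⟨M, ?_, ?_, hMpos, ?_⟩
    · have himage : Subtype.val '' ((T.comap ((↑) : {j // j ≠ l} → W)).neighborSet x') =
          T.neighborSet x \ {l} := by
        ext y
        constructor
        · rintro ⟨z, hz, rfl⟩
          exact ⟨hz, z.2⟩
        · rintro ⟨hy, hyl⟩
          exact ⟨⟨y, hyl⟩, hy, rfl⟩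
      rw [hcard, ← Set.ncard_image_of_injective _ Subtype.val_injective, himage]
      by_cases hxp : x = p
      · subst hxp
        have hmem : l ∈ T.neighborSet x := hlp.symm
        rw [← Set.ncard_sdiff_singleton_add_one hmem]
        simp [L', x']
        omega
      · rw [Set.sdiff_singleton_eq_self fun h => hxp (hl x h.symm)]
        simp [L', x', hxp]
    · rw [hsum, Fintype.sum_eq_add_sum_subtype_ne _ l]
      have : ∀ i : {j // j ≠ l}, (L' i).sum =
          (if i = ⟨p, hpl⟩ then (L l).sum + 1 else 0) + (L i).sum := by
        intro i
        by_cases hi : (i : W) = p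
        · have : i = ⟨p, hpl⟩ := Subtype.ext hi
          subst this
          simp [L']
        · have : i ≠ ⟨p, hpl⟩ := fun h => hi (congrArg Subtype.val h)
          simp [L', hi, this]
      simp only [this, sum_add_distrib, sum_ite_eq', mem_univ, if_true]
      omega
    · rw [weightedHom_eq_of_leaf hlp hl]
      exact hM

end LoopGraph

/-! ### Trees without a vertex of degree three -/

namespace SimpleGraph

variable {W : Type v} [Finite W] {G : SimpleGraph W}

/-- In a connected graph of maximum degree at most two, a longest path visits every vertex:
otherwise an edge leaves the path, which gives a longer path if it starts at an end of the path, and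
a vertex of degree three if it starts inside. -/
theorem Walk.IsPath.mem_support_of_longest {u v : W} {p : G.Walk u v} (hG : G.Connected)
    (hdeg : ∀ x, (G.neighborSet x).ncard ≤ 2) (hp : p.IsPath)
    (hmax : ∀ (u' v' : W) (q : G.Walk u' v'), q.IsPath → q.length ≤ p.length) (x : W) :
    x ∈ p.support := by
  by_contra hx
  obtain ⟨q⟩ := hG.preconnected u x
  obtain ⟨d, -, hd, hd'⟩ := q.exists_boundary_dart {y | y ∈ p.support} p.start_mem_support hx
  obtain ⟨⟨a, b⟩, hab⟩ := d
  obtain ⟨i, hi, hil⟩ := Walk.mem_support_iff_exists_getVert.1 hd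
  simp only [Set.mem_ofPred_eq] at hd hd'
  have hab : G.Adj a b := hab
  change p.getVert i = a at hi
  rcases Nat.eq_zero_or_pos i with rfl | hi0
  · rw [Walk.getVert_zero] at hi
    subst hi
    have := hmax _ _ (Walk.cons hab.symm p) (hp.cons hd')
    simp at this
  rcases hil.eq_or_lt with rfl | hil
  · rw [Walk.getVert_length] at hi
    subst hi
    have := hmax _ _ (p.concat hab) (hp.concat hd' hab)
    simp at this
  obtain ⟨j, rfl⟩ := Nat.exists_eq_succ_of_ne_zero hi0.ne'
  simp only [Nat.succ_eq_add_one] at *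
  have h₁ : G.Adj a (p.getVert j) := hi ▸ (p.adj_getVert_succ (by omega)).symm
  have h₂ : G.Adj a (p.getVert (j + 2)) := hi ▸ p.adj_getVert_succ hil
  have hne : p.getVert j ≠ p.getVert (j + 2) := fun h => by
    have := hp.getVert_injOn (x₁ := j) (x₂ := j + 2) (Set.mem_ofPred.2 (by omega))
      (Set.mem_ofPred.2 (by omega)) h
    omega
  have hb : ∀ k, b ≠ p.getVert k := fun k h => hd' (h ▸ p.getVert_mem_support k)
  have hsub : {b, p.getVert j, p.getVert (j + 2)} ⊆ G.neighborSet a := by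
    rintro y (rfl | rfl | rfl)
    · exact hab
    · exact h₁
    · exact h₂
  have hcard : ({b, p.getVert j, p.getVert (j + 2)} : Set W).ncard = 3 :=
    Set.ncard_eq_three.2 ⟨_, _, _, hb _, hb _, hne, rfl⟩
  have := Set.ncard_le_ncard hsub (Set.toFinite _)
  have := hdeg a
  omega

theorem IsTree.nonempty_iso_pathGraph {n : ℕ} (hG : G.IsTree) (hn : Nat.card W = n)
    (hdeg : ∀ x, (G.neighborSet x).ncard ≤ 2) : Nonempty (G ≃g pathGraph n) := by
  classical
  have := Fintype.ofFinite W
  have := hG.connected.nonempty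
  obtain ⟨u, v, p, hp, hmax⟩ := Walk.exists_isPath_forall_isPath_length_le_length G
  have hham : p.IsHamiltonian :=
    hp.isHamiltonian_of_mem (hp.mem_support_of_longest hG.connected hdeg hmax)
  have hlen : p.length + 1 = n := by
    rw [← hn, Nat.card_eq_fintype_card, ← hham.length_support, p.length_support]
  subst hlen
  have hbij : Function.Bijective hp.pathGraphCopy := by
    rw [Fintype.bijective_iff_injective_and_card]
    exact ⟨hp.pathGraphCopy.injective, by simpa [Nat.card_eq_fintype_card] using hn.symm⟩
  let e : Fin (p.length + 1) ≃ W := Equiv.ofBijective _ hbij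
  have hle : pathGraph (p.length + 1) ≤ G.comap e := fun i j h => hp.pathGraphCopy.toHom.map_adj h
  have htree : (G.comap e).IsTree := (Iso.comap e G).isTree_iff.2 hG
  have heq : pathGraph (p.length + 1) = G.comap e :=
    le_antisymm hle ((isTree_iff_minimal_connected.1 htree).le_of_le (pathGraph_connected _) hle)
  rw [heq]
  exact ⟨(Iso.comap e G).symm⟩

theorem ncard_neighborSet_pathGraph_le {n : ℕ} (i : Fin n) :
    ((pathGraph n).neighborSet i).ncard ≤ 2 := by
  by_contra h
  obtain ⟨a, b, c, ha, hb, hc, hab, hac, hbc⟩ := (Set.two_lt_ncard_iff (Set.toFinite _)).1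
    (not_le.1 h)
  simp only [mem_neighborSet, pathGraph_adj] at ha hb hc
  rw [Ne, Fin.ext_iff] at hab hac hbc
  omega

/-- A spanning tree of the path has maximum degree at most two, hence is itself isomorphic to the
path. -/
theorem isTree_pathGraph (n : ℕ) : (pathGraph (n + 1)).IsTree := by
  obtain ⟨T, hle, hT⟩ := (pathGraph_connected n).exists_isTree_le
  obtain ⟨e⟩ := hT.nonempty_iso_pathGraph (Nat.card_fin _) fun i =>
    (Set.ncard_le_ncard (fun _ h => hle h) (Set.toFinite _)).trans
      (ncard_neighborSet_pathGraph_le i)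
  exact e.isTree_iff.1 hT

theorem not_nonempty_starGraph_iso_pathGraph :
    ¬ Nonempty (starGraph (0 : Fin 4) ≃g pathGraph 4) := by
  rintro ⟨e⟩
  have h : ∀ i : Fin 4, i ≠ 0 → (pathGraph 4).Adj (e 0) (e i) := fun i hi =>
    e.map_adj_iff.2 (by simp [hi.symm])
  have h₁ := h 1 (by decide)
  have h₂ := h 2 (by decide)
  have h₃ := h 3 (by decide)
  have h₁₂ : e 1 ≠ e 2 := e.injective.ne (by decide)
  have h₁₃ : e 1 ≠ e 3 := e.injective.ne (by decide)
  have h₂₃ : e 2 ≠ e 3 := e.injective.ne (by decide)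
  simp only [pathGraph_adj] at h₁ h₂ h₃
  rw [Ne, Fin.ext_iff] at h₁₂ h₁₃ h₂₃
  omega

end SimpleGraph

/-! ### Comparing a tree with the path -/

namespace LoopGraph

variable {V : Type u} {H : LoopGraph V}

section Fintype

variable [Fintype V]

theorem IsNested.exists_hom_ge {n : ℕ} (hH : H.IsNested) {T : SimpleGraph (Fin (n + 1))}
    (hT : T.IsTree) (x : Fin (n + 1)) :
    ∃ M : Multiset ℕ, M.card = (T.neighborSet x).ncard ∧ M.sum = n ∧ (∀ t ∈ M, 0 < t) ∧
      1 ⬝ᵥ H.walkProd M ≤ hom T H := by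
  obtain ⟨M, h₁, h₂, h₃, h₄⟩ := exists_weightedHom_ge n T hT (Fintype.card_fin _) x 1
    (fun _ => nbhdMono_one) (fun _ => 0) (fun _ => Dominates.refl _) (by simp) hH
  refine ⟨M, by simpa using h₁, by simpa using h₂, h₃, ?_⟩
  rwa [hom_eq_weightedHom]

theorem IsNested.hom_pathGraph_le (hH : H.IsNested) {n : ℕ} {T : SimpleGraph (Fin (n + 1))}
    (hT : T.IsTree) : hom (SimpleGraph.pathGraph (n + 1)) H ≤ hom T H := by
  obtain ⟨M, -, rfl, -, hM⟩ := hH.exists_hom_ge hT 0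
  rw [hom_pathGraph]
  exact (hH.dominates_walkProd M 1 nbhdMono_one).trans hM

theorem IsSeparated.hom_pathGraph_lt {d a b : V} (h : H.IsSeparated d a b) (hH : H.IsNested)
    {n : ℕ} {T : SimpleGraph (Fin (n + 1))} (hT : T.IsTree)
    (hpath : ¬ Nonempty (T ≃g SimpleGraph.pathGraph (n + 1))) :
    hom (SimpleGraph.pathGraph (n + 1)) H < hom T H := by
  obtain ⟨x, hx⟩ : ∃ x, 2 < (T.neighborSet x).ncard := by
    by_contra! hdeg
    exact hpath (hT.nonempty_iso_pathGraph (Nat.card_fin _) hdeg)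
  obtain ⟨M, hcard, rfl, hpos, hM⟩ := hH.exists_hom_ge hT x
  rw [hom_pathGraph]
  exact (h.walkCount_lt_walkProd hH (by omega) hpos).trans_le hM

end Fintype

/-- Not being fully looped complete already excludes the edgeless case, since a non-isolated vertex
has a non-isolated neighbour. The vertex `d` is one of maximum degree; nestedness makes its
neighbourhood the largest, so it contains every non-isolated vertex, `d` included. -/
theorem exists_isSeparated [Finite V] (hH : H.IsNested)
    (hC : ¬ H.deleteIsolated.IsFullyLoopedComplete) :
    ∃ d a b, H.IsSeparated d a b := by
  simp only [IsFullyLoopedComplete, not_forall] at hC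
  obtain ⟨a, b, hab⟩ := hC
  have : Nonempty V := ⟨a⟩
  obtain ⟨d, hd⟩ : ∃ d, ∀ a x, H.Adj a x → H.Adj d x := by
    obtain ⟨d, hd⟩ := Finite.exists_max fun a => {x | H.Adj a x}.ncard
    refine ⟨d, fun a => (hH a d).elim id fun h => ?_⟩
    have := Set.eq_of_subset_of_ncard_le (s := {x | H.Adj d x}) (t := {x | H.Adj a x}) h (hd a)
    exact fun x hx => this.symm.subset hx
  have hex : ∀ c : V, ¬ H.IsIsolated c → H.Adj d c := fun c hc => by
    simp only [IsIsolated, not_forall] at hc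
    obtain ⟨y, hy, -⟩ := hc
    exact hd y c (H.symm hy)
  have ha := hex a a.2
  exact ⟨d, a, b, hd a d (H.symm ha), ha, hex b b.2, hab, hd a⟩

/-- In the two exceptional cases adjacency is transitive. -/
theorem adj_trans_of_deleteIsolated
    (h : H.deleteIsolated.IsEdgeless ∨ H.deleteIsolated.IsFullyLoopedComplete) {a b c : V}
    (hab : H.Adj a b) (hbc : H.Adj b c) : H.Adj a c := by
  by_cases hne : b = a
  · exact hne ▸ hbc
  by_cases hne' : c = b
  · exact hne' ▸ hab
  have hA : ¬ H.IsIsolated a := fun h => hne (h b hab)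
  have hB : ¬ H.IsIsolated b := fun h => hne' (h c hbc)
  have hC : ¬ H.IsIsolated c := fun h => hne' (h b (H.symm hbc)).symm
  rcases h with h | h
  · exact (h ⟨a, hA⟩ ⟨b, hB⟩ hab).elim
  · exact h ⟨a, hA⟩ ⟨c, hC⟩

/-- If adjacency in `H` is transitive, the colorings of a connected graph with at least two vertices
depend only on its vertex set. -/
theorem isColoring_iff_of_trans {W : Type v} [Nontrivial W] {T : SimpleGraph W}
    (hT : T.Connected) (htr : ∀ {a b c}, H.Adj a b → H.Adj b c → H.Adj a c) (f : W → V) :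
    IsColoring T H f ↔ ∀ i j, H.Adj (f i) (f j) := by
  refine ⟨fun hf i j => ?_, fun hf i j _ => hf i j⟩
  have hloop : ∀ i, H.Adj (f i) (f i) := fun i => by
    obtain ⟨k, hk⟩ := hT.preconnected.exists_adj_of_nontrivial i
    exact htr (hf i k hk) (hf k i hk.symm)
  obtain ⟨p⟩ := hT.preconnected i j
  induction p with
  | nil => exact hloop _
  | cons h _ ih => exact htr (hf _ _ h) ih

theorem hom_eq_of_trans {W : Type v} [Nontrivial W] {S T : SimpleGraph W} (hS : S.Connected)
    (hT : T.Connected) (htr : ∀ {a b c}, H.Adj a b → H.Adj b c → H.Adj a c) :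
    hom S H = hom T H := by
  rw [hom_eq_card, hom_eq_card]
  simp only [isColoring_iff_of_trans hS htr, isColoring_iff_of_trans hT htr]

end LoopGraph

theorem theorem4p10 {V : Type*} [Finite V] (H : LoopGraph V) (hH : H.IsLoopThreshold) :
    H.IsHoffmanLondon ∧
      (H.IsStronglyHoffmanLondon ↔
        ¬ (H.deleteIsolated.IsEdgeless ∨ H.deleteIsolated.IsFullyLoopedComplete)) := by
  have := Fintype.ofFinite V
  have hN := hH.isNested
  refine ⟨fun n hn => ?_, fun hS h => ?_, fun h n hn T hT hpath => ?_⟩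
  · obtain ⟨n, rfl⟩ := Nat.exists_eq_succ_of_ne_zero (by omega : n ≠ 0)
    refine ⟨⟨_, SimpleGraph.isTree_pathGraph n, rfl⟩, ?_⟩
    rintro _ ⟨T, hT, rfl⟩
    exact hN.hom_pathGraph_le hT
  -- The star on four vertices is the smallest tree that is not a path.
  · have hlt := hS 4 (by omega) (SimpleGraph.starGraph 0) (SimpleGraph.isTree_starGraph 0)
      SimpleGraph.not_nonempty_starGraph_iso_pathGraph
    exact hlt.ne (LoopGraph.hom_eq_of_trans (SimpleGraph.pathGraph_connected 3)
      (SimpleGraph.isTree_starGraph 0).connected (LoopGraph.adj_trans_of_deleteIsolated h))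
  · obtain ⟨d, a, b, hd⟩ := LoopGraph.exists_isSeparated hN (not_or.1 h).2
    obtain ⟨n, rfl⟩ := Nat.exists_eq_succ_of_ne_zero (by omega : n ≠ 0)
    exact hd.hom_pathGraph_lt hN hT hpath
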